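/- Consider a school choice problem with a finite set $I$ of students, a set $S$ of schools, a strict preference list for every student (over all or some of the schools), and for every school $s$ a number of seats and a strict priority order $\succ_s$ of the students. For a profile of submitted lists, the SOSM matching is the result of student-proposing deferred acceptance: in every step each student who is not tentatively placed proposes to the next school on her list, and every school keeps the best students, up to its capacity, among those it holds and the new proposers, and rejects the rest. Let $M_S$ be the SOSM matching for the true preferences ($M_S[i]$ may be "no school", ranked below all listed schools). A pair $(i,s)$ is an interrupting pair of step $t'$ of a run of deferred acceptance if $i$ is tentatively placed in $s$ at some step $t<t'$, is rejected from $s$ at step $t'$, and some other student is rejected from $s$ at a step $r$ with $t\le r<t'$. Let $W\subseteq I$ be any set of consenting students. EADAM runs SOSM and finds the last step that has an interrupting pair $(i,s)$ with $i\in W$; it removes $s$ from the list of $i$ for all such pairs of that step (the last interrupting pairs of the round), and repeats this with the new lists until no such pair exists. Let $M_E$ be the resulting matching. The consenting last interrupters are the students $i\in W$ for which $(i,s)$ is a last interrupting pair of some round, for some school $s$. **Theorem.** For every $W\subseteq I$ there is a permutation $\sigma$ of $I$ such that the following hold. 1. The cabal $K=\{i : \sigma(i)\neq i\}$ is exactly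 $\{i : M_S[i]\ne M_E[i]\}$; every $i\in K$ strictly prefers $M_S[\sigma(i)]$ to $M_S[i]$ (so that the cycles $(i_1 \to i_m\to\cdots\to i_2\to i_1)$ of $\sigma$ on $K$, with $\sigma(i_k)=i_{k-1}$, are cabal loops); and $M_E[i]=M_S[\sigma(i)]$ for all $i\in I$. If $M_E\ne M_S$, then $M_E$ Pareto dominates $M_S$. 2. Say that $s$ obstructs for $i$ if for some $k\in K$ we have $s=M_S[k]$, $i$ prefers $s$ to $M_S[i]$, and $i\succ_s\sigma^{-1}(k)$. Let $X_i$ be the set of all such schools $s$ with $s\neq M_S[\sigma(i)]$. Write the true list of $i$ as $(P_L[i],M_S[i],P_R[i])$. If all consenting last interrupters (the accomplices) submit falsified lists of the form $(P_L[i]\setminus X_i,\ M_S[i],\ P_R[i]\cup X_i)$ and all other students submit their true lists, then the SOSM outcome is $M_E$. The same is true if instead the accomplices are all students $i$ for whom some school obstructs. In a falsified list the part to the right of $M_S[i]$ may be in any order, and so may the part to the left if $i\notin K$; if $i\in K$, the part to the left keeps its true order. So for every set of consenting students the EADAM outcome is obtained by a coalition that improves on SOSM (trivially if $M_E=M_S$).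 In particular ($W=I$), EADAM with full consent is a coalition improvement. -/

import Mathlib

/-- A school choice problem with student set `I` and school set `S`.
`pref i` is the strict preference list of student `i`, best school first (schools that are not
listed are unacceptable to `i`; the list may contain all schools).  `rank s` is the strict priority
structure of school `s`: `rank s i < rank s j` means that `s` prioritizes `i` over `j`.
`cap s` is the number of seats of `s`. -/
structure SchoolChoice (I S : Type*) where
  pref : I → List S
  pref_nodup : ∀ i, (pref i).Nodup
  rank : S → I → ℕ
  rank_injective : ∀ s, Function.Injective (rank s)
  cap : S → ℕ

namespace SchoolChoice

section Defs

variable {I S : Type*} [Fintype I] [DecidableEq S] (E : SchoolChoice I S)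

/-! ### Student proposing deferred acceptance (SOSM), step by step

The state is a list `rem i` for every student `i`: the part of the submitted list of `i` that starts
with the school to which `i` is currently proposing or at which `i` is tentatively placed. Steps are
numbered from `0`. In a step every school considers all the students whose current school it is
(those it holds and the new proposers), keeps the best ones up to its capacity and
rejects all the others, who then move on to the next school of their lists.
Student `i` is unassigned (`none`) once the list is exhausted. -/

/-- In state `rem`, school `s` is the current school of `i` and `s` rejects `i`: already
`cap s` students of higher priority are at `s`. -/
def Rejects (rem : I → List S) (i : I) (s : S) : Prop :=
  (rem i).head? = some s ∧
    E.cap s ≤ (Finset.univ.filter fun j =>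
      (rem j).head? = some s ∧ E.rank s j < E.rank s i).card

open Classical in
/-- One step of deferred acceptance. -/
noncomputable def daStep (rem : I → List S) : I → List S := fun i =>
  if ∃ s, E.Rejects rem i s then (rem i).tail else rem i

/-- The state at the beginning of step `t`, for the submitted profile `P`. -/
noncomputable def daState (P : I → List S) (t : ℕ) : I → List S := E.daStep^[t] P

/-- An upper bound for the number of rejections: the total length of all lists. -/
def totalLength (P : I → List S) : ℕ := ∑ i, (P i).length

/-- The outcome matching of SOSM for the submitted profile `P` (the procedure has
stopped after `totalLength P` steps, see `daStep_daState_totalLength`). -/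
noncomputable def da (P : I → List S) : I → Option S := fun i =>
  (E.daState P (totalLength P) i).head?

/-- The SOSM matching under the true preferences. -/
noncomputable def sosm : I → Option S := E.da E.pref

/-- Student `i` is tentatively placed in `s` at step `t`. -/
def PlacedAt (P : I → List S) (t : ℕ) (i : I) (s : S) : Prop :=
  (E.daState P t i).head? = some s ∧ ¬ E.Rejects (E.daState P t) i s

/-- Student `i` is rejected from `s` at step `t`. -/
def RejectedAt (P : I → List S) (t : ℕ) (i : I) (s : S) : Prop :=
  E.Rejects (E.daState P t) i s

/-! ### EADAM -/

/-- `(i, s)` is an interrupting pair of step `t'`: student `i` is tentatively placed in `s` at some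
step `t` and rejected from it at the later step `t'`, and some other student is rejected from `s`
after step `t - 1` and before step `t'`. -/
def InterruptingPair (P : I → List S) (i : I) (s : S) (t' : ℕ) : Prop :=
  E.RejectedAt P t' i s ∧
    ∃ t, t < t' ∧ E.PlacedAt P t i s ∧
      ∃ r, t ≤ r ∧ r < t' ∧ ∃ j, j ≠ i ∧ E.RejectedAt P r j s

/-- `(i, s)` is a last interrupting pair with a consenting interrupter: `i ∈ W`, and `(i, s)` is
an interrupting pair of the last step that has an interrupting pair with a student in `W`. -/
def LastPair (W : Set I) (P : I → List S) (i : I) (s : S) : Prop :=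
  i ∈ W ∧ ∃ t', E.InterruptingPair P i s t' ∧
    ∀ j ∈ W, ∀ u t'', E.InterruptingPair P j u t'' → t'' ≤ t'

open Classical in
/-- One round of EADAM: every last interrupting pair `(i, s)` leads to the removal of `s` from
the list of `i`. -/
noncomputable def eadamRound (W : Set I) (P : I → List S) : I → List S := fun i =>
  (P i).filter fun s => ¬ E.LastPair W P i s

/-- The preference profile after `k` rounds of EADAM with set `W` of consenting students. -/
noncomputable def eadamProfile (W : Set I) (k : ℕ) : I → List S := (E.eadamRound W)^[k] E.pref

/-- The EADAM matching with set `W` of consenting students (the procedure has stopped after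
`totalLength E.pref` rounds, see `not_lastPair_eadamProfile_totalLength`). -/
noncomputable def eadam (W : Set I) : I → Option S :=
  E.da (E.eadamProfile W (totalLength E.pref))

/-- The consenting last interrupters: the students `i ∈ W` such that `(i, s)` is a last
interrupting pair at some round of EADAM, for some school `s`. -/
def lastInterrupters (W : Set I) : Set I :=
  {i | ∃ k s, E.LastPair W (E.eadamProfile W k) i s}

/-! ### Comparing assignments -/

/-- The position of an assignment (a school or no school) in a preference list; "no school" comes
after all listed schools. -/
def position (l : List S) : Option S → ℕ
  | some s => l.idxOf s
  | none => l.length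

/-- Student `i` truly prefers assignment `a` to assignment `b`. -/
def Prefers (i : I) (a b : Option S) : Prop :=
  position (E.pref i) a < position (E.pref i) b

/-- Matching `M'` Pareto dominates matching `M`. -/
def ParetoDominates (M' M : I → Option S) : Prop :=
  (∀ i, position (E.pref i) (M' i) ≤ position (E.pref i) (M i)) ∧
    ∃ j, E.Prefers j (M' j) (M j)

/-! ### Coalitions

A cabal that is split into disjoint cabal loops is given by a permutation `σ` of the students: the
cabal is the set of the students moved by `σ`, the loops are the cycles of `σ`, and `σ` maps a student
`i_k` of a loop to `i_(k-1)`, the student whose SOSM assignment `i_k` desires. So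
`σ⁻¹` maps `i_k` to `i_(k+1)`. -/

/-- Every student in the cabal prefers the SOSM assignment of the preceding student of the loop to
his own SOSM assignment. -/
def IsCabal (σ : Equiv.Perm I) : Prop :=
  ∀ i, σ i ≠ i → E.Prefers i (E.sosm (σ i)) (E.sosm i)

/-- School `s` is the SOSM assignment of some `i_k` in the cabal, student `i` prefers it to his own
SOSM assignment, and `s` ranks `i` higher than `i_(k+1)`, who desires the seat of `i_k`. -/
def Obstructs (σ : Equiv.Perm I) (i : I) (s : S) : Prop :=
  ∃ k, σ k ≠ k ∧ E.sosm k = some s ∧ E.Prefers i (some s) (E.sosm i) ∧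
    E.rank s i < E.rank s (σ⁻¹ k)

/-- The accomplice set of a cabal. -/
def accomplices (σ : Equiv.Perm I) : Set I := {i | ∃ s, E.Obstructs σ i s}

/-- The set `X` of schools that student `i` moves down if he is asked to falsify his list. The school
that the cabal wants to obtain for `i` himself is exempt; if every school has one seat, then this
school never satisfies `Obstructs`. -/
def moved (σ : Equiv.Perm I) (i : I) : Set S :=
  {s | E.Obstructs σ i s ∧ E.sosm (σ i) ≠ some s}

/-- The part of the true list of `i` to the left of his SOSM assignment. -/
noncomputable def leftPart (i : I) : List S :=
  match E.sosm i with
  | some s => (E.pref i).takeWhile fun u => u ≠ s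
  | none => E.pref i

/-- The part of the true list of `i` to the right of his SOSM assignment. -/
noncomputable def rightPart (i : I) : List S :=
  match E.sosm i with
  | some s => ((E.pref i).dropWhile fun u => u ≠ s).tail
  | none => []

open Classical in
/-- `l` is a falsified list of student `i`, of the form `(P_L - X, M[i], P_R ∪ X)` for the SOSM matching
`M`. The part on the right may be in any order, and so may the part on the left if `i` is
not in the cabal; a member of the cabal keeps the part on the left in its true order.
If `i` is unassigned, then everything to the right of "no school" is not listed. -/
def IsFalsifiedList (σ : Equiv.Perm I) (i : I) (l : List S) : Prop :=
  ∃ L R : List S,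
    L.Perm ((E.leftPart i).filter fun s => s ∉ E.moved σ i) ∧
    (σ i ≠ i → L = (E.leftPart i).filter fun s => s ∉ E.moved σ i) ∧
    R.Perm (E.rightPart i ++ (E.leftPart i).filter fun s => s ∈ E.moved σ i) ∧
    l = match E.sosm i with
      | some s => L ++ s :: R
      | none => L

/-- `P` is a profile that may be submitted by the coalition with cabal `σ` and accomplice set `A`:
the accomplices submit falsified lists, all other students submit their true lists. -/
def IsCoalitionProfile (σ : Equiv.Perm I) (A : Set I) (P : I → List S) : Prop :=
  ∀ i, (i ∈ A → E.IsFalsifiedList σ i (P i)) ∧ (i ∉ A → P i = E.pref i)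

/-! ### The two procedures stop -/

theorem iterate_fixed {α : Type*} (f : α → α) (μ : α → ℕ)
    (h : ∀ x, f x ≠ x → μ (f x) < μ x) (n : ℕ) (x : α) (hn : μ x ≤ n) :
    f (f^[n] x) = f^[n] x := by
  induction n generalizing x with
  | zero =>
    by_contra hx
    have := h x hx
    omega
  | succ n ih =>
    by_cases hx : f x = x
    · rw [Function.iterate_fixed hx, hx]
    · have := h x hx
      rw [Function.iterate_succ_apply]
      exact ih (f x) (by omega)

/-- Deferred acceptance has stopped after `totalLength P` steps. -/
theorem daStep_daState_totalLength (P : I → List S) :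
    E.daStep (E.daState P (totalLength P)) = E.daState P (totalLength P) := by
  refine iterate_fixed E.daStep totalLength (fun rem hne => ?_) _ P le_rfl
  have hle : ∀ i, (E.daStep rem i).length ≤ (rem i).length := by
    intro i
    unfold daStep
    split_ifs
    · simp
    · exact le_rfl
  obtain ⟨i, hi⟩ := Function.ne_iff.mp hne
  refine Finset.sum_lt_sum (fun i _ => hle i) ⟨i, Finset.mem_univ i, ?_⟩
  unfold daStep at hi ⊢
  split_ifs at hi ⊢ with hr
  · obtain ⟨s, hs, -⟩ := hr
    cases hl : rem i with
    | nil => simp [hl] at hs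
    | cons a l => simp
  · exact absurd rfl hi

theorem daState_sublist (P : I → List S) (t : ℕ) (i : I) :
    (E.daState P t i).Sublist (P i) := by
  induction t with
  | zero => exact List.Sublist.refl _
  | succ t ih =>
    have hs : E.daState P (t + 1) = E.daStep (E.daState P t) :=
      Function.iterate_succ_apply' _ _ _
    rw [hs]
    unfold daStep
    split_ifs
    · exact (List.tail_sublist _).trans ih
    · exact ih

/-- EADAM has stopped after `totalLength E.pref` rounds: no last interrupting pair is left to be
treated. -/
theorem not_lastPair_eadamProfile_totalLength (W : Set I) (i : I) (s : S) :
    ¬ E.LastPair W (E.eadamProfile W (totalLength E.pref)) i s := by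
  have hfix : E.eadamRound W (E.eadamProfile W (totalLength E.pref)) =
      E.eadamProfile W (totalLength E.pref) := by
    refine iterate_fixed (E.eadamRound W) totalLength (fun P hne => ?_) _ E.pref le_rfl
    obtain ⟨i, hi⟩ := Function.ne_iff.mp hne
    refine Finset.sum_lt_sum (fun i _ => List.length_filter_le _ _) ⟨i, Finset.mem_univ i, ?_⟩
    refine lt_of_le_of_ne (List.length_filter_le _ _) (fun h => hi ?_)
    exact List.filter_sublist.eq_of_length h
  intro h
  obtain ⟨-, t, hint, -⟩ := id h
  have hmem : s ∈ E.eadamProfile W (totalLength E.pref) i :=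
    (E.daState_sublist _ t i).subset (List.mem_of_mem_head? hint.1.1)
  rw [← hfix] at hmem
  simp only [eadamRound, List.mem_filter, decide_eq_true_eq] at hmem
  exact hmem.2 h

end Defs

end SchoolChoice

/-! Let M be the SOSM and N the EADAM matching. Each removed school had already rejected its
student, so the old outcome stays stable for the shortened lists; as deferred acceptance is
student-optimal, N is weakly better than M for everybody. A feasible matching weakly better than M
fills equally many seats at every school (`Feasible.card_eq`), so M and N have fibres of equal size
and differ by a permutation that fixes every student with M = N. The core is constrained efficiency
(`eq_eadam_of_respectsPriorities`): a feasible D that assigns only listed schools, is weakly better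
than N and violates no priority of a student outside W equals N. By `exists_interruptingPair_gt`, a
rejection from a D-assignment is followed by an interrupting pair with interrupter in W. So a last
pair never removes a D-assignment, and after the final round nobody is rejected from one. For a
coalition profile Q, a school that would break the stability of N obstructs and has been moved down.
Hence N is stable for Q, and the outcome D of Q is weakly better than N. D respects the true
priorities outside W: a student there either submits her true list, or is a cabal member who keeps
its order and moves down nothing truly better than N, as otherwise she would be a consenting
interrupter (`Obstructs.mem_lastInterrupters`). Efficiency gives D = N. -/

namespace SchoolChoice

/-! ### Positions in preference lists, followed by two counting facts -/

section Lists

variable {S : Type*} [DecidableEq S]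

theorem position_le_length (l : List S) (a : Option S) : position l a ≤ l.length := by
  cases a with
  | none => exact le_rfl
  | some s => exact List.idxOf_le_length

theorem mem_of_position_lt {l : List S} {s : S} {a : Option S}
    (h : position l (some s) < position l a) : s ∈ l :=
  List.idxOf_lt_length_iff.mp (h.trans_le (position_le_length l a))

theorem position_some_lt_length {l : List S} {s : S} (h : s ∈ l) :
    position l (some s) < l.length :=
  List.idxOf_lt_length_iff.mpr h

theorem eq_of_position_eq {l : List S} {a b : Option S} (ha : ∀ s, a = some s → s ∈ l)
    (hb : ∀ s, b = some s → s ∈ l) (h : position l a = position l b) : a = b := by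
  cases a with
  | none =>
    cases b with
    | none => rfl
    | some t => exact absurd h (position_some_lt_length (hb t rfl)).ne'
  | some s =>
    cases b with
    | none => exact absurd h (position_some_lt_length (ha s rfl)).ne
    | some t => exact congrArg some ((List.idxOf_inj (ha s rfl)).mp h)

/-- "No school" has position `length`, so the formula also covers an exhausted list. -/
theorem position_append_head? {l₁ l₂ : List S} (h : (l₁ ++ l₂).Nodup) :
    position (l₁ ++ l₂) l₂.head? = l₁.length := by
  cases l₂ with
  | nil => simp [position]
  | cons a l =>
    have ha : a ∉ l₁ := fun h' => (List.disjoint_of_nodup_append h) h' (by simp)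
    simp [position, List.idxOf_append_of_notMem ha]

theorem position_append_of_mem {l₁ l₂ : List S} {s : S} (h : s ∈ l₁) :
    position (l₁ ++ l₂) (some s) = position l₁ (some s) :=
  List.idxOf_append_of_mem h

theorem position_append_lt_iff {l₁ l₂ : List S} {s : S} :
    position (l₁ ++ l₂) (some s) < l₁.length ↔ s ∈ l₁ := by
  by_cases h : s ∈ l₁
  · simp only [position_append_of_mem h, position_some_lt_length h, h]
  · simp [position, List.idxOf_append_of_notMem h, h]

theorem idxOf_lt_idxOf_of_sublist {l' l : List S} (hl : l'.Sublist l) (hn : l.Nodup) {s u : S}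
    (hs : s ∈ l') (hu : u ∈ l') : l'.idxOf s < l'.idxOf u ↔ l.idxOf s < l.idxOf u := by
  induction hl with
  | slnil => simp at hs
  | @cons l₁ l₂ a h ih =>
    obtain ⟨ha, hn⟩ := List.nodup_cons.mp hn
    have hsa : a ≠ s := fun e => ha (e ▸ h.subset hs)
    have hua : a ≠ u := fun e => ha (e ▸ h.subset hu)
    rw [List.idxOf_cons_ne _ hsa, List.idxOf_cons_ne _ hua, ih hn hs hu]
    omega
  | @cons_cons l₁ l₂ a h ih =>
    obtain ⟨ha, hn⟩ := List.nodup_cons.mp hn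
    by_cases hua : a = u
    · subst hua; simp
    by_cases hsa : a = s
    · subst hsa; simp [List.idxOf_cons_ne _ hua]
    have hs' : s ∈ l₁ := (List.mem_cons.mp hs).resolve_left (Ne.symm hsa)
    have hu' : u ∈ l₁ := (List.mem_cons.mp hu).resolve_left (Ne.symm hua)
    simp only [List.idxOf_cons_ne _ hsa, List.idxOf_cons_ne _ hua]
    have := ih hn hs' hu'
    omega

theorem position_lt_iff_of_sublist {l' l : List S} (hl : l'.Sublist l) (hn : l.Nodup)
    {a b : Option S} (ha : ∀ s, a = some s → s ∈ l') (hb : ∀ s, b = some s → s ∈ l') :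
    position l' a < position l' b ↔ position l a < position l b := by
  cases a with
  | none =>
    exact iff_of_false (position_le_length _ _).not_gt (position_le_length _ _).not_gt
  | some s =>
    cases b with
    | none =>
      exact iff_of_true (position_some_lt_length (ha s rfl))
        (position_some_lt_length (hl.subset (ha s rfl)))
    | some u => exact idxOf_lt_idxOf_of_sublist hl hn (ha s rfl) (hb u rfl)

theorem position_le_iff_of_sublist {l' l : List S} (hl : l'.Sublist l) (hn : l.Nodup)
    {a b : Option S} (ha : ∀ s, a = some s → s ∈ l') (hb : ∀ s, b = some s → s ∈ l') :
    position l' a ≤ position l' b ↔ position l a ≤ position l b := by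
  rw [← not_lt, ← not_lt, position_lt_iff_of_sublist hl hn hb ha]

end Lists

/-- In a finite set with an injective ranking, the elements with fewer than `c` better elements
are `c` in number, if the set is large enough. -/
theorem card_filter_card_lt {α : Type*} (A : Finset α) {f : α → ℕ} (hf : Function.Injective f)
    {c : ℕ} (hc : c ≤ A.card) :
    (A.filter fun a => (A.filter fun b => f b < f a).card < c).card = c := by
  classical
  set B := A.filter fun a => (A.filter fun b => f b < f a).card < c with hB
  apply le_antisymm
  · by_contra! h
    -- All other elements of `B` are better than its worst element, which has fewer than `c` better
    -- ones.
    obtain ⟨m, hm, hmax⟩ := B.exists_max_image f (Finset.card_pos.mp (by omega))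
    have h1 := (Finset.mem_filter.mp hm).2
    have h2 : B.erase m ⊆ A.filter fun b => f b < f m := fun x hx => by
      obtain ⟨hne, hx⟩ := Finset.mem_erase.mp hx
      exact Finset.mem_filter.mpr ⟨(Finset.mem_filter.mp hx).1,
        lt_of_le_of_ne (hmax x hx) fun e => hne (hf e)⟩
    have h3 := Finset.card_le_card h2
    rw [Finset.card_erase_of_mem hm] at h3
    omega
  · by_contra! h
    have hne : (A \ B).Nonempty := by
      rw [← Finset.card_pos]
      have := Finset.le_card_sdiff B A
      omega
    -- Everything better than the best element outside `B` lies in `B`, which is too small to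
    -- exclude it.
    obtain ⟨m, hm, hmin⟩ := (A \ B).exists_min_image f hne
    obtain ⟨hmA, hmB⟩ := Finset.mem_sdiff.mp hm
    refine hmB (Finset.mem_filter.mpr ⟨hmA, lt_of_le_of_lt (Finset.card_le_card ?_) h⟩)
    intro x hx
    obtain ⟨hxA, hx⟩ := Finset.mem_filter.mp hx
    by_contra hxB
    exact (hmin x (Finset.mem_sdiff.mpr ⟨hxA, hxB⟩)).not_gt hx

/-- Two functions on a finite type with fibres of equal size differ by a permutation that moves
exactly the points at which they differ. -/
theorem exists_perm_comp_eq {I α : Type*} [Fintype I] [DecidableEq α] (M N : I → α)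
    (h : ∀ a, (Finset.univ.filter fun i => N i = a).card =
      (Finset.univ.filter fun i => M i = a).card) :
    ∃ σ : Equiv.Perm I, (∀ i, N i = M (σ i)) ∧ ∀ i, σ i ≠ i ↔ M i ≠ N i := by
  classical
  -- Matching fibres only inside `K` keeps all other points fixed; fibre sizes still agree there,
  -- because the parts outside `K` coincide.
  let K := {i // M i ≠ N i}
  have hK : ∀ a, Nonempty ({i : K // N i = a} ≃ {i : K // M i = a}) := by
    intro a
    rw [← Fintype.card_eq]
    have key : ∀ F : I → α, Fintype.card {i : K // F i = a} +
        (Finset.univ.filter fun i => F i = a ∧ M i = N i).card =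
        (Finset.univ.filter fun i => F i = a).card := by
      intro F
      have e : Fintype.card {i : K // F i = a} =
          (Finset.univ.filter fun i => F i = a ∧ ¬ M i = N i).card := by
        rw [Fintype.card_congr (Equiv.subtypeSubtypeEquivSubtypeInter (fun i => M i ≠ N i)
          (fun i => F i = a)), Fintype.card_subtype]
        congr 1
        ext i
        simp [and_comm]
      rw [e, ← Finset.filter_filter, ← Finset.filter_filter, add_comm,
        Finset.card_filter_add_card_filter_not]
    have h1 := key N
    have h2 := key M
    have h3 : (Finset.univ.filter fun i => N i = a ∧ M i = N i) =
        (Finset.univ.filter fun i => M i = a ∧ M i = N i) := by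
      ext i
      simp only [Finset.mem_filter, Finset.mem_univ, true_and]
      constructor
      · rintro ⟨h, h'⟩; exact ⟨h'.trans h, h'⟩
      · rintro ⟨h, h'⟩; exact ⟨h'.symm.trans h, h'⟩
    have := h a
    rw [h3] at h1
    omega
  let τ : Equiv.Perm K := Equiv.ofFiberEquiv (f := fun i : K => N i) (g := fun i : K => M i)
    fun a => (hK a).some
  have hτ : ∀ i : K, M (τ i) = N i := fun i =>
    Equiv.ofFiberEquiv_map (f := fun i : K => N i) (g := fun i : K => M i) _ i
  have hcomp : ∀ i, N i = M (Equiv.Perm.ofSubtype τ i) := by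
    intro i
    by_cases hi : M i ≠ N i
    · rw [Equiv.Perm.ofSubtype_apply_of_mem τ hi]
      exact (hτ ⟨i, hi⟩).symm
    · rw [Equiv.Perm.ofSubtype_apply_of_not_mem τ hi]
      exact (not_not.mp hi).symm
  refine ⟨Equiv.Perm.ofSubtype τ, hcomp, fun i => ⟨fun hi => ?_, fun hi he => ?_⟩⟩
  · by_contra h'
    exact hi (Equiv.Perm.ofSubtype_apply_of_not_mem τ (by simpa using h'))
  · have := hcomp i
    rw [he] at this
    exact hi this.symm

end SchoolChoice

namespace SchoolChoice

/-! ### Deferred acceptance: stability, student-optimality and seat counts -/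

section DeferredAcceptance

variable {I S : Type*} [Fintype I] [DecidableEq S] (E : SchoolChoice I S)

/-- The number of schools that have rejected student `i` before step `t`. -/
noncomputable def stage (P : I → List S) (t : ℕ) (i : I) : ℕ :=
  (P i).length - (E.daState P t i).length

theorem daState_succ (P : I → List S) (t : ℕ) :
    E.daState P (t + 1) = E.daStep (E.daState P t) :=
  Function.iterate_succ_apply' _ _ _

theorem daState_suffix (P : I → List S) (t : ℕ) (i : I) : E.daState P t i <:+ P i := by
  induction t with
  | zero => exact List.suffix_refl _
  | succ t ih =>
    rw [daState_succ]
    unfold daStep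
    split_ifs
    · exact (List.tail_suffix _).trans ih
    · exact ih

theorem exists_append_daState (P : I → List S) (t : ℕ) (i : I) :
    ∃ l, P i = l ++ E.daState P t i ∧ l.length = E.stage P t i := by
  obtain ⟨l, hl⟩ := E.daState_suffix P t i
  refine ⟨l, hl.symm, ?_⟩
  have := congrArg List.length hl
  rw [List.length_append] at this
  unfold stage
  omega

/-- This translates positions in the submitted list into rejection counts, including the case of an
exhausted list. -/
theorem position_head?_daState {P : I → List S} (hP : ∀ i, (P i).Nodup) (t : ℕ) (i : I) :
    position (P i) (E.daState P t i).head? = E.stage P t i := by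
  obtain ⟨l, hl, hn⟩ := E.exists_append_daState P t i
  have h := hP i
  rw [hl] at h ⊢
  rw [position_append_head? h, hn]

theorem head?_daState_mem (P : I → List S) (t : ℕ) (i : I) (s : S)
    (h : (E.daState P t i).head? = some s) : s ∈ P i :=
  (E.daState_sublist P t i).subset (List.mem_of_mem_head? h)

theorem stage_zero (P : I → List S) (i : I) : E.stage P 0 i = 0 := by
  simp [stage, daState]

theorem RejectedAt.stage_succ {E : SchoolChoice I S} {P : I → List S} {t : ℕ} {i : I} {s : S}
    (h : E.RejectedAt P t i s) : E.stage P (t + 1) i = E.stage P t i + 1 := by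
  have h1 : E.daState P (t + 1) i = (E.daState P t i).tail := by
    rw [daState_succ]
    exact if_pos ⟨s, h⟩
  have h2 : E.daState P t i ≠ [] := fun e => by
    have := h.1
    simp [e] at this
  have h3 := List.length_pos_iff.mpr h2
  have h4 := (E.daState_sublist P t i).length_le
  simp only [stage, h1, List.length_tail]
  omega

theorem daState_succ_of_not_rejectedAt {P : I → List S} {t : ℕ} {i : I}
    (h : ¬ ∃ s, E.RejectedAt P t i s) : E.daState P (t + 1) i = E.daState P t i := by
  rw [daState_succ]
  exact if_neg h

theorem stage_le_succ (P : I → List S) (t : ℕ) (i : I) :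
    E.stage P t i ≤ E.stage P (t + 1) i := by
  by_cases h : ∃ s, E.RejectedAt P t i s
  · obtain ⟨s, hs⟩ := h
    rw [hs.stage_succ]
    omega
  · simp only [stage, E.daState_succ_of_not_rejectedAt h, le_refl]

theorem exists_rejectedAt_of_stage_ne {P : I → List S} {t : ℕ} {i : I}
    (h : E.stage P (t + 1) i ≠ E.stage P t i) : ∃ s, E.RejectedAt P t i s := by
  by_contra hr
  exact h (by simp only [stage, E.daState_succ_of_not_rejectedAt hr])

theorem stage_mono (P : I → List S) (i : I) : Monotone fun t => E.stage P t i :=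
  monotone_nat_of_le_succ fun t => E.stage_le_succ P t i

theorem RejectedAt.position {E : SchoolChoice I S} {P : I → List S} (hP : ∀ i, (P i).Nodup)
    {t : ℕ} {i : I} {s : S} (h : E.RejectedAt P t i s) :
    position (P i) (some s) = E.stage P t i := by
  rw [← h.1, E.position_head?_daState hP]

/-- A student has been rejected by all the schools that precede the current one. -/
theorem exists_rejectedAt_of_position_lt {P : I → List S} (hP : ∀ i, (P i).Nodup) {t : ℕ} {i : I}
    {s : S} (h : position (P i) (some s) < E.stage P t i) :
    ∃ r < t, E.RejectedAt P r i s := by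
  induction t with
  | zero => simp [stage_zero] at h
  | succ t ih =>
    by_cases h' : position (P i) (some s) < E.stage P t i
    · obtain ⟨r, hr, hs⟩ := ih h'
      exact ⟨r, by omega, hs⟩
    · obtain ⟨u, hu⟩ := E.exists_rejectedAt_of_stage_ne (P := P) (t := t) (i := i) (by omega)
      have h1 := hu.stage_succ
      have h2 := hu.position hP
      have : some u = some s := eq_of_position_eq
        (fun v hv => by obtain rfl := Option.some.inj hv; exact E.head?_daState_mem P t i u hu.1)
        (fun v hv => by
          obtain rfl := Option.some.inj hv
          obtain ⟨l, hl, hn⟩ := E.exists_append_daState P (t + 1) i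
          have : s ∈ l := by
            rw [← hn, hl] at h
            exact position_append_lt_iff.mp h
          rw [hl]
          exact List.mem_append_left _ this)
        (by omega)
      obtain rfl := Option.some.inj this
      exact ⟨t, by omega, hu⟩

theorem daState_of_totalLength_le (P : I → List S) {t : ℕ} (ht : totalLength P ≤ t) :
    E.daState P t = E.daState P (totalLength P) := by
  induction t, ht using Nat.le_induction with
  | base => rfl
  | succ t _ ih => rw [daState_succ, ih, daStep_daState_totalLength]

theorem RejectedAt.lt_totalLength {E : SchoolChoice I S} {P : I → List S} {t : ℕ} {i : I} {s : S}
    (h : E.RejectedAt P t i s) : t < totalLength P := by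
  by_contra! ht
  have h1 := h.stage_succ
  simp only [stage, E.daState_of_totalLength_le P ht,
    E.daState_of_totalLength_le P (show totalLength P ≤ t + 1 by omega)] at h1
  omega

theorem position_da {P : I → List S} (hP : ∀ i, (P i).Nodup) (i : I) :
    position (P i) (E.da P i) = E.stage P (totalLength P) i :=
  E.position_head?_daState hP _ i

theorem da_mem (P : I → List S) (i : I) (s : S) (h : E.da P i = some s) : s ∈ P i :=
  E.head?_daState_mem P _ i s h

theorem stage_le_position_da {P : I → List S} (hP : ∀ i, (P i).Nodup) (t : ℕ) (i : I) :
    E.stage P t i ≤ position (P i) (E.da P i) := by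
  rw [E.position_da hP]
  rcases le_total t (totalLength P) with h | h
  · exact E.stage_mono P i h
  · simp only [stage, E.daState_of_totalLength_le P h, le_refl]

theorem RejectedAt.position_lt {E : SchoolChoice I S} {P : I → List S} (hP : ∀ i, (P i).Nodup)
    {t : ℕ} {i : I} {s : S} (h : E.RejectedAt P t i s) :
    SchoolChoice.position (P i) (some s) < SchoolChoice.position (P i) (E.da P i) := by
  have h1 := E.stage_le_position_da hP (t + 1) i
  rw [h.stage_succ] at h1
  rw [h.position hP]
  omega

/-- The students whose current school is `s`. -/
noncomputable def current (P : I → List S) (t : ℕ) (s : S) : Finset I :=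
  Finset.univ.filter fun j => (E.daState P t j).head? = some s

/-- The students whom `s` keeps in step `t`. -/
noncomputable def held (P : I → List S) (t : ℕ) (s : S) : Finset I :=
  (E.current P t s).filter fun j =>
    ((E.current P t s).filter fun k => E.rank s k < E.rank s j).card < E.cap s

theorem mem_current {P : I → List S} {t : ℕ} {s : S} {j : I} :
    j ∈ E.current P t s ↔ (E.daState P t j).head? = some s := by
  simp [current]

theorem rejectedAt_iff {P : I → List S} {t : ℕ} {s : S} {j : I} :
    E.RejectedAt P t j s ↔ j ∈ E.current P t s ∧
      E.cap s ≤ ((E.current P t s).filter fun k => E.rank s k < E.rank s j).card := by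
  rw [mem_current, current, Finset.filter_filter]
  rfl

theorem mem_held {P : I → List S} {t : ℕ} {s : S} {j : I} :
    j ∈ E.held P t s ↔ E.PlacedAt P t j s := by
  have := E.rejectedAt_iff (P := P) (t := t) (s := s) (j := j)
  unfold RejectedAt at this
  rw [held, PlacedAt, Finset.mem_filter, this, mem_current]
  constructor
  · rintro ⟨h, h'⟩
    exact ⟨h, fun h'' => h''.2.not_gt h'⟩
  · rintro ⟨h, h'⟩
    exact ⟨h, lt_of_not_ge fun h'' => h' ⟨h, h''⟩⟩

theorem PlacedAt.head?_succ {E : SchoolChoice I S} {P : I → List S} {t : ℕ} {i : I} {s : S}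
    (h : E.PlacedAt P t i s) : (E.daState P (t + 1) i).head? = some s := by
  rw [E.daState_succ_of_not_rejectedAt, h.1]
  rintro ⟨u, hu⟩
  obtain rfl : u = s := Option.some.inj (hu.1.symm.trans h.1)
  exact h.2 hu

theorem card_held_le (P : I → List S) (t : ℕ) (s : S) : (E.held P t s).card ≤ E.cap s := by
  by_cases h : E.cap s ≤ (E.current P t s).card
  · exact (card_filter_card_lt _ (E.rank_injective s) h).le
  · exact (Finset.card_le_card (Finset.filter_subset _ _)).trans (by omega)

theorem card_held_eq {P : I → List S} {t : ℕ} {s : S} {i : I}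
    (h : E.cap s ≤ ((E.current P t s).filter fun k => E.rank s k < E.rank s i).card) :
    (E.held P t s).card = E.cap s :=
  card_filter_card_lt _ (E.rank_injective s)
    (h.trans (Finset.card_le_card (Finset.filter_subset _ _)))

theorem rank_lt_of_placedAt {P : I → List S} {t : ℕ} {s : S} {i j : I}
    (h : E.cap s ≤ ((E.current P t s).filter fun k => E.rank s k < E.rank s i).card)
    (hj : E.PlacedAt P t j s) : E.rank s j < E.rank s i := by
  by_contra! hij
  have h1 := (Finset.mem_filter.mp (E.mem_held.mpr hj)).2
  refine (h.trans (Finset.card_le_card fun k hk => ?_)).not_gt h1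
  obtain ⟨hk1, hk2⟩ := Finset.mem_filter.mp hk
  exact Finset.mem_filter.mpr ⟨hk1, hk2.trans_le hij⟩

/-- Once `s` has rejected `i`, it stays full with students of higher priority. -/
theorem RejectedAt.cap_le_card {E : SchoolChoice I S} {P : I → List S} {r t : ℕ} {i : I} {s : S}
    (h : E.RejectedAt P r i s) (hrt : r ≤ t) :
    E.cap s ≤ ((E.current P t s).filter fun k => E.rank s k < E.rank s i).card := by
  induction t, hrt using Nat.le_induction with
  | base => exact (E.rejectedAt_iff.mp h).2
  | succ t _ ih =>
    rw [← E.card_held_eq ih]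
    refine Finset.card_le_card fun j hj => ?_
    have hj' := E.mem_held.mp hj
    exact Finset.mem_filter.mpr
      ⟨E.mem_current.mpr hj'.head?_succ, E.rank_lt_of_placedAt ih hj'⟩

/-- A new student at a full school displaces a student who was held there. -/
theorem exists_placedAt_rejectedAt_succ {P : I → List S} {t : ℕ} {s : S} {i : I}
    (hfull : (E.held P t s).card = E.cap s) (h1 : ¬ E.PlacedAt P t i s)
    (h2 : E.PlacedAt P (t + 1) i s) :
    ∃ j, E.PlacedAt P t j s ∧ E.RejectedAt P (t + 1) j s := by
  classical
  by_contra! h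
  have hsub : insert i (E.held P t s) ⊆ E.held P (t + 1) s := by
    intro j hj
    rcases Finset.mem_insert.mp hj with rfl | hj
    · exact E.mem_held.mpr h2
    · have hj' := E.mem_held.mp hj
      exact E.mem_held.mpr ⟨hj'.head?_succ, h j hj'⟩
  have h3 := Finset.card_le_card hsub
  rw [Finset.card_insert_of_notMem fun hi => h1 (E.mem_held.mp hi)] at h3
  have := E.card_held_le P (t + 1) s
  omega

/-- No school has more students than seats. -/
def Feasible (N : I → Option S) : Prop :=
  ∀ s, (Finset.univ.filter fun j => N j = some s).card ≤ E.cap s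

/-- Every school that a student with list `P i` prefers to the assignment `N i` has filled its
seats with students of higher priority. -/
def StableFor (P : I → List S) (N : I → Option S) : Prop :=
  ∀ i s, position (P i) (some s) < position (P i) (N i) →
    E.cap s ≤ (Finset.univ.filter fun j => N j = some s ∧ E.rank s j < E.rank s i).card

theorem da_feasible (P : I → List S) : E.Feasible (E.da P) := by
  intro s
  have h : (Finset.univ.filter fun j => E.da P j = some s) = E.held P (totalLength P) s := by
    ext j
    simp only [mem_held, Finset.mem_filter, Finset.mem_univ, true_and]
    exact ⟨fun h => ⟨h, fun hr => lt_irrefl _ (RejectedAt.lt_totalLength hr)⟩, fun h => h.1⟩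
  rw [h]
  exact E.card_held_le _ _ _

theorem da_stableFor {P : I → List S} (hP : ∀ i, (P i).Nodup) : E.StableFor P (E.da P) := by
  intro i s h
  rw [E.position_da hP] at h
  obtain ⟨r, hr, hs⟩ := E.exists_rejectedAt_of_position_lt hP h
  have := hs.cap_le_card hr.le
  rwa [current, Finset.filter_filter] at this

variable {E}

/-- The occupants that beat `i` already fill all seats, so there are no other occupants. -/
theorem Feasible.rank_lt {N : I → Option S} (hN : E.Feasible N) {i j : I} {s : S}
    (h : E.cap s ≤ (Finset.univ.filter fun j => N j = some s ∧ E.rank s j < E.rank s i).card)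
    (hj : N j = some s) : E.rank s j < E.rank s i := by
  have hsub : (Finset.univ.filter fun j => N j = some s ∧ E.rank s j < E.rank s i) ⊆
      Finset.univ.filter fun j => N j = some s := by
    intro k
    simp only [Finset.mem_filter, Finset.mem_univ, true_and]
    exact fun h => h.1
  have heq := Finset.eq_of_subset_of_card_le hsub ((hN s).trans h)
  have : j ∈ Finset.univ.filter fun j => N j = some s := by simpa using hj
  rw [← heq] at this
  exact (Finset.mem_filter.mp this).2.2

/-- No student is rejected from her assignment in a stable matching. -/
theorem StableFor.not_rejectedAt {P : I → List S} (hP : ∀ i, (P i).Nodup) {N : I → Option S}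
    (hst : E.StableFor P N) (hf : E.Feasible N) (hmem : ∀ i s, N i = some s → s ∈ P i)
    (t : ℕ) : ∀ i s, N i = some s → ¬ E.RejectedAt P t i s := by
  induction t using Nat.strong_induction_on with
  | _ t ih =>
    intro i s hi hr
    -- Since `i` takes one seat of `s` in `N`, not all of the at least `cap s` better students at
    -- `s` can belong there.
    obtain ⟨h, hh⟩ : ∃ h ∈ (E.current P t s).filter fun k => E.rank s k < E.rank s i,
        N h ≠ some s := by
      by_contra! hall
      have hsub : (E.current P t s).filter (fun k => E.rank s k < E.rank s i) ⊂
          Finset.univ.filter fun j => N j = some s := by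
        refine (Finset.ssubset_iff_of_subset fun k hk => ?_).mpr ⟨i, ?_, ?_⟩
        · simpa using hall k hk
        · simpa using hi
        · simp
      have h1 := Finset.card_lt_card hsub
      have h2 := hf s
      have h3 := (E.rejectedAt_iff.mp hr).2
      omega
    obtain ⟨⟨hcur, hrank⟩, hne⟩ := And.intro (Finset.mem_filter.mp hh.1) hh.2
    rw [mem_current] at hcur
    have hpos := E.position_head?_daState hP t h
    rw [hcur] at hpos
    -- Otherwise `h` would have been rejected from `N h` before proposing to `s`, against the
    -- induction hypothesis.
    have hlt : position (P h) (some s) < position (P h) (N h) := by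
      refine lt_of_le_of_ne ?_ fun e => hne (eq_of_position_eq ?_ (hmem h) e).symm
      · by_contra! hlt
        cases hN : N h with
        | none =>
          rw [hN] at hlt
          exact (position_le_length _ _).not_gt hlt
        | some u =>
          rw [hN, hpos] at hlt
          obtain ⟨r, hr, hu⟩ := E.exists_rejectedAt_of_position_lt hP hlt
          exact ih r hr h u hN hu
      · rintro u ⟨⟩
        exact E.head?_daState_mem P t h s hcur
    exact (hf.rank_lt (hst h s hlt) hi).not_gt hrank

theorem StableFor.position_da_le {P : I → List S} (hP : ∀ i, (P i).Nodup) {N : I → Option S}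
    (hst : E.StableFor P N) (hf : E.Feasible N) (hmem : ∀ i s, N i = some s → s ∈ P i) (i : I) :
    position (P i) (E.da P i) ≤ position (P i) (N i) := by
  cases hN : N i with
  | none => exact position_le_length _ _
  | some s =>
    by_contra! h
    rw [E.position_da hP] at h
    obtain ⟨r, -, hr⟩ := E.exists_rejectedAt_of_position_lt hP h
    exact hst.not_rejectedAt hP hf hmem r i s hN hr

/-- A feasible matching that is weakly better than the deferred acceptance outcome for all students
fills the same number of seats at every school. -/
theorem Feasible.card_eq {P : I → List S} (hP : ∀ i, (P i).Nodup) {N : I → Option S}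
    (hf : E.Feasible N) (hmem : ∀ i s, N i = some s → s ∈ P i)
    (hle : ∀ i, position (P i) (N i) ≤ position (P i) (E.da P i)) (a : Option S) :
    (Finset.univ.filter fun i => N i = a).card =
      (Finset.univ.filter fun i => E.da P i = a).card := by
  classical
  -- A newcomer of a fibre strictly gains, so the fibre belongs to a school that was already full.
  have key : ∀ a, (Finset.univ.filter fun i => N i = a).card ≤
      (Finset.univ.filter fun i => E.da P i = a).card := by
    intro a
    by_cases hsub : ∀ i, N i = a → E.da P i = a
    · exact Finset.card_le_card fun i hi => by
        simp only [Finset.mem_filter, Finset.mem_univ, true_and] at hi ⊢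
        exact hsub i hi
    · push Not at hsub
      obtain ⟨i, hi, hne⟩ := hsub
      have hlt : position (P i) (N i) < position (P i) (E.da P i) :=
        lt_of_le_of_ne (hle i) fun e =>
          hne ((eq_of_position_eq (hmem i) (E.da_mem P i) e).symm.trans hi)
      cases a with
      | none =>
        rw [hi] at hlt
        exact absurd hlt (position_le_length _ _).not_gt
      | some s =>
        rw [hi] at hlt
        refine (hf s).trans ((E.da_stableFor hP i s hlt).trans (Finset.card_le_card ?_))
        intro k
        simp only [Finset.mem_filter, Finset.mem_univ, true_and]
        exact fun h => h.1
  -- Both families of fibre sizes sum to the number of students, so the termwise inequalities are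
  -- equalities.
  let U : Finset (Option S) := insert a (Finset.univ.image N ∪ Finset.univ.image (E.da P))
  have h1 : (Finset.univ : Finset I).card =
      ∑ b ∈ U, (Finset.univ.filter fun i => N i = b).card :=
    Finset.card_eq_sum_card_fiberwise fun i _ => by simp [U]
  have h2 : (Finset.univ : Finset I).card =
      ∑ b ∈ U, (Finset.univ.filter fun i => E.da P i = b).card :=
    Finset.card_eq_sum_card_fiberwise fun i _ => by simp [U]
  exact (Finset.sum_eq_sum_iff_of_le fun b _ => key b).mp (h1.symm.trans h2) a (by simp [U])

end DeferredAcceptance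

end SchoolChoice

namespace SchoolChoice

/-! ### Rejections from a better matching force later interruptions -/

section Efficiency

variable {I S : Type*} [Fintype I] [DecidableEq S] {E : SchoolChoice I S}

/-- No student outside `W` (with list `P i`) prefers a school to the assignment in `D` that admits a
student of lower priority. -/
def RespectsPriorities (E : SchoolChoice I S) (W : Set I) (P : I → List S) (D : I → Option S) :
    Prop :=
  ∀ h ∉ W, ∀ s, position (P h) (some s) < position (P h) (D h) →
    ∀ j, D j = some s → ¬ E.rank s h < E.rank s j

/-- A student who is held at a full school and rejected in the next step is an interrupter, if the
school has rejected somebody of lower priority before. -/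
theorem interruptingPair_of_rejectedAt_succ {P : I → List S} {r t : ℕ} {h i : I} {s : S}
    (hi : E.RejectedAt P r i s) (hrt : r ≤ t) (hh : E.PlacedAt P t h s)
    (hrej : E.RejectedAt P (t + 1) h s) : E.InterruptingPair P h s (t + 1) := by
  refine ⟨hrej, ?_⟩
  -- If `h` is held when `i` is rejected, that rejection is the witness. Otherwise `h` enters the
  -- full school later and displaces another student.
  by_cases hr : E.PlacedAt P r h s
  · exact ⟨r, by omega, hr, r, le_rfl, by omega, i, fun e => hr.2 (e ▸ hi), hi⟩
  · obtain ⟨q, hq1, hq2, hq3, hq4⟩ :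
        ∃ q, r ≤ q ∧ q + 1 ≤ t ∧ ¬ E.PlacedAt P q h s ∧ E.PlacedAt P (q + 1) h s := by
      clear hrej
      induction t, hrt using Nat.le_induction with
      | base => exact absurd hh hr
      | succ t ht ih =>
        by_cases ht' : E.PlacedAt P t h s
        · obtain ⟨q, h1, h2, h3⟩ := ih ht'
          exact ⟨q, h1, by omega, h3⟩
        · exact ⟨t, ht, le_rfl, ht', hh⟩
    obtain ⟨j, hj1, hj2⟩ := E.exists_placedAt_rejectedAt_succ
      (E.card_held_eq (hi.cap_le_card hq1)) hq3 hq4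
    exact ⟨q + 1, by omega, hq4, q + 1, le_rfl, by omega, j, fun e => hq3 (e ▸ hj1), hj2⟩

/-- Step `r` is the rejection that sends `i` to her final assignment. -/
theorem exists_last_rejection {P : I → List S} {t : ℕ} {i : I}
    (h : E.stage P t i < E.stage P (totalLength P) i) :
    ∃ r, t ≤ r ∧ E.stage P r i < E.stage P (r + 1) i ∧
      E.stage P (r + 1) i = E.stage P (totalLength P) i := by
  have ht : t ≤ totalLength P := by
    by_contra! h'
    exact h.not_ge (E.stage_mono P i h'.le)
  classical
  have hex : ∃ q, E.stage P (totalLength P) i ≤ E.stage P q i := ⟨_, le_rfl⟩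
  have hq := Nat.find_spec hex
  set q := Nat.find hex with hqdef
  have hqT : q ≤ totalLength P := Nat.find_min' hex le_rfl
  have htq : t < q := by
    by_contra! h'
    exact (h.trans_le hq).not_ge (E.stage_mono P i h')
  obtain ⟨r, hqr⟩ : ∃ r, q = r + 1 := ⟨q - 1, by omega⟩
  have hr := Nat.find_min hex (m := r) (by omega)
  rw [hqr] at hq hqT
  exact ⟨r, by omega, by omega, le_antisymm (E.stage_mono P i hqT) hq⟩

/-- Suppose that all students weakly prefer `D` to the deferred acceptance outcome, and that `D`
respects the priorities of the students outside `W`. If a student is rejected from her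
assignment in `D`, then there is an interrupting pair of a later step with an interrupter in `W`. -/
theorem exists_interruptingPair_gt {W : Set I} {P : I → List S} (hP : ∀ i, (P i).Nodup)
    {D : I → Option S} (hf : E.Feasible D) (hmem : ∀ i s, D i = some s → s ∈ P i)
    (hle : ∀ i, position (P i) (D i) ≤ position (P i) (E.da P i))
    (hD : E.RespectsPriorities W P D) {t : ℕ} {i : I} {s : S} (hi : D i = some s)
    (hrej : E.RejectedAt P t i s) :
    ∃ t', t < t' ∧ ∃ h ∈ W, ∃ u, E.InterruptingPair P h u t' := by
  classical
  by_contra! hno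
  -- the last step in which somebody is rejected from the assignment in `D`
  obtain ⟨r, htr, ⟨i₀, s₀, hi₀, hr₀⟩, hrmax⟩ : ∃ r, t ≤ r ∧
      (∃ i s, D i = some s ∧ E.RejectedAt P r i s) ∧
      ∀ r', (∃ i s, D i = some s ∧ E.RejectedAt P r' i s) → r' ≤ r := by
    have hb : ∀ r', (∃ i s, D i = some s ∧ E.RejectedAt P r' i s) → r' ≤ totalLength P :=
      fun r' ⟨_, _, _, h⟩ => h.lt_totalLength.le
    refine ⟨Nat.findGreatest (fun r' => ∃ i s, D i = some s ∧ E.RejectedAt P r' i s)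
      (totalLength P), ?_, ?_, fun r' h => ?_⟩
    · exact Nat.le_findGreatest (hb t ⟨i, s, hi, hrej⟩) ⟨i, s, hi, hrej⟩
    · exact Nat.findGreatest_spec (P := fun r' => ∃ i s, D i = some s ∧ E.RejectedAt P r' i s)
        (hb t ⟨i, s, hi, hrej⟩) ⟨i, s, hi, hrej⟩
    · exact Nat.le_findGreatest (hb r' h) h
  -- the last later step in which somebody who is better off in `D` reaches the final school
  let B : ℕ → Prop := fun q => r ≤ q ∧ ∃ b, D b ≠ E.da P b ∧
    E.stage P q b < E.stage P (q + 1) b ∧ E.stage P (q + 1) b = E.stage P (totalLength P) b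
  have hBle : ∀ q, B q → q ≤ totalLength P := by
    rintro q ⟨-, b, -, h1, -⟩
    obtain ⟨u, hu⟩ := E.exists_rejectedAt_of_stage_ne h1.ne'
    exact hu.lt_totalLength.le
  have hBex : ∃ q, B q := by
    have h1 := hr₀.position_lt hP
    have h2 : E.stage P r i₀ < E.stage P (totalLength P) i₀ := by
      rw [← hr₀.position hP, ← E.position_da hP]
      exact h1
    obtain ⟨q, hq⟩ := exists_last_rejection h2
    refine ⟨q, hq.1, i₀, fun e => ?_, hq.2⟩
    rw [← e, hi₀] at h1
    exact lt_irrefl _ h1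
  obtain ⟨q, ⟨hrq, b, hb, hlt, hfin⟩, hqmax⟩ : ∃ q, B q ∧ ∀ q', B q' → q' ≤ q := by
    obtain ⟨q₀, hq₀⟩ := hBex
    exact ⟨Nat.findGreatest B (totalLength P),
      Nat.findGreatest_spec (hBle q₀ hq₀) hq₀,
      fun q' h => Nat.le_findGreatest (hBle q' h) h⟩
  have hcard := hf.card_eq hP hmem hle
  -- Whoever is unassigned in `D` is unassigned in the outcome; equal counts make the two sets
  -- equal, which excludes `b`.
  obtain ⟨u, hu⟩ : ∃ u, E.da P b = some u := by
    rw [← Option.ne_none_iff_exists']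
    intro hnone
    have hsub : (Finset.univ.filter fun i => D i = none) ⊆
        Finset.univ.filter fun i => E.da P i = none := by
      intro i hi
      simp only [Finset.mem_filter, Finset.mem_univ, true_and] at hi ⊢
      have h := hle i
      rw [hi] at h
      exact eq_of_position_eq (E.da_mem P i) (by simp)
        (le_antisymm (position_le_length _ _) h)
    have heq := Finset.eq_of_subset_of_card_le hsub (hcard none).ge
    have : b ∈ Finset.univ.filter fun i => E.da P i = none := by simpa using hnone
    rw [← heq] at this
    exact hb ((Finset.mem_filter.mp this).2.trans hnone.symm)
  -- School `u` has equally many students in both matchings, and `b` is there only in the outcome.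
  obtain ⟨i₁, hi₁, hi₁'⟩ : ∃ i₁, D i₁ = some u ∧ E.da P i₁ ≠ some u := by
    by_contra! hall
    have hsub : (Finset.univ.filter fun i => D i = some u) ⊆
        Finset.univ.filter fun i => E.da P i = some u := by
      intro i hi
      simp only [Finset.mem_filter, Finset.mem_univ, true_and] at hi ⊢
      exact hall i hi
    have heq := Finset.eq_of_subset_of_card_le hsub (hcard (some u)).ge
    have : b ∈ Finset.univ.filter fun i => E.da P i = some u := by simpa using hu
    rw [← heq] at this
    exact hb ((Finset.mem_filter.mp this).2.trans hu.symm)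
  obtain ⟨r₁, hr₁⟩ : ∃ r₁, E.RejectedAt P r₁ i₁ u := by
    have h1 : position (P i₁) (some u) < position (P i₁) (E.da P i₁) := by
      refine lt_of_le_of_ne (hi₁ ▸ hle i₁) fun e => hi₁' ?_
      exact (eq_of_position_eq (fun v hv => hmem i₁ v (hi₁.trans hv)) (E.da_mem P i₁) e).symm
    rw [E.position_da hP] at h1
    obtain ⟨r₁, -, h⟩ := E.exists_rejectedAt_of_position_lt hP h1
    exact ⟨r₁, h⟩
  have hr₁q : r₁ ≤ q := (hrmax r₁ ⟨i₁, u, hi₁, hr₁⟩).trans hrq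
  have hposb : position (P b) (some u) = E.stage P (totalLength P) b := by
    rw [← hu, E.position_da hP]
  have hb1 : ¬ E.PlacedAt P q b u := fun h => by
    have := E.position_head?_daState hP q b
    rw [h.1] at this
    omega
  have hb2 : E.PlacedAt P (q + 1) b u := by
    refine ⟨eq_of_position_eq (E.head?_daState_mem P _ b) ?_ ?_, fun h => ?_⟩
    · rintro v ⟨⟩
      exact E.da_mem P b u hu
    · rw [E.position_head?_daState hP, hfin, hposb]
    · have h1 := RejectedAt.position_lt hP (t := q + 1) h
      rw [hu] at h1
      exact lt_irrefl _ h1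
  have hcap := hr₁.cap_le_card hr₁q
  -- Since `u` rejected `i₁` at some `r₁ ≤ q`, it is full, and the arrival of `b` at step `q + 1`
  -- displaces some `h` with priority over `i₁`.
  obtain ⟨h, hh1, hh2⟩ := E.exists_placedAt_rejectedAt_succ (E.card_held_eq hcap) hb1 hb2
  have hrank := E.rank_lt_of_placedAt hcap hh1
  have hW : h ∉ W := fun hW =>
    hno (q + 1) (by omega) h hW u (interruptingPair_of_rejectedAt_succ hr₁ hr₁q hh1 hh2)
  have hne : D h ≠ some u := fun e => by
    have := hrmax (q + 1) ⟨h, u, e, hh2⟩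
    omega
  -- Outside `W`, `h` cannot envy `i₁` in `D`. So `h` is better off in `D` and reaches her final
  -- assignment after `b`, against the choice of `q`.
  have hnlt : ¬ position (P h) (some u) < position (P h) (D h) := fun hlt' =>
    hD h hW u hlt' i₁ hi₁ hrank
  have hDda : D h ≠ E.da P h := fun e => hnlt (by rw [e]; exact hh2.position_lt hP)
  have hst : E.stage P (q + 1) h < E.stage P (totalLength P) h := by
    rw [← hh2.position hP, ← E.position_da hP]
    exact hh2.position_lt hP
  obtain ⟨q', hq', hq''⟩ := exists_last_rejection hst
  have := hqmax q' ⟨by omega, h, hDda, hq''⟩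
  omega

end Efficiency

/-! ### Monotonicity and constrained efficiency of EADAM -/

section Eadam

variable {I S : Type*} [Fintype I] [DecidableEq S] (E : SchoolChoice I S) (W : Set I)

theorem eadamProfile_succ (k : ℕ) :
    E.eadamProfile W (k + 1) = E.eadamRound W (E.eadamProfile W k) :=
  Function.iterate_succ_apply' _ _ _

theorem eadamProfile_sublist (k : ℕ) (i : I) : (E.eadamProfile W k i).Sublist (E.pref i) := by
  induction k with
  | zero => exact List.Sublist.refl _
  | succ k ih =>
    rw [eadamProfile_succ]
    exact List.filter_sublist.trans ih

theorem eadamProfile_nodup (k : ℕ) (i : I) : (E.eadamProfile W k i).Nodup :=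
  (E.pref_nodup i).sublist (E.eadamProfile_sublist W k i)

theorem mem_eadamProfile_succ {k : ℕ} {i : I} {s : S} :
    s ∈ E.eadamProfile W (k + 1) i ↔
      s ∈ E.eadamProfile W k i ∧ ¬ E.LastPair W (E.eadamProfile W k) i s := by
  rw [eadamProfile_succ]
  simp [eadamRound]

theorem eadamProfile_of_notMem {i : I} (hi : i ∉ E.lastInterrupters W) (k : ℕ) :
    E.eadamProfile W k i = E.pref i := by
  induction k with
  | zero => rfl
  | succ k ih =>
    rw [eadamProfile_succ, eadamRound, List.filter_eq_self.mpr, ih]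
    intro s _
    simpa using fun h => hi ⟨k, s, h⟩

theorem lastInterrupters_subset : E.lastInterrupters W ⊆ W :=
  fun _ ⟨_, _, h⟩ => h.1

theorem da_eadamProfile_mem_succ (k : ℕ) (i : I) (s : S)
    (h : E.da (E.eadamProfile W k) i = some s) : s ∈ E.eadamProfile W (k + 1) i := by
  refine (E.mem_eadamProfile_succ W).mpr ⟨E.da_mem _ i s h, fun ⟨_, t, ht, _⟩ => ?_⟩
  have := RejectedAt.position_lt (E.eadamProfile_nodup W k) ht.1
  rw [h] at this
  exact lt_irrefl _ this

/-- Shortening lists creates no new claims, so the old outcome remains stable, and the new one is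
student-optimal. -/
theorem position_da_eadamProfile_succ_le (k : ℕ) (i : I) :
    position (E.pref i) (E.da (E.eadamProfile W (k + 1)) i) ≤
      position (E.pref i) (E.da (E.eadamProfile W k) i) := by
  have hsub : ∀ i, (E.eadamProfile W (k + 1) i).Sublist (E.eadamProfile W k i) := fun i => by
    rw [eadamProfile_succ]
    exact List.filter_sublist
  have hst : E.StableFor (E.eadamProfile W (k + 1)) (E.da (E.eadamProfile W k)) := by
    intro j s h
    refine E.da_stableFor (E.eadamProfile_nodup W k) j s ?_
    refine (position_lt_iff_of_sublist (hsub j) (E.eadamProfile_nodup W k j) ?_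
      (E.da_eadamProfile_mem_succ W k j)).mp h
    rintro u ⟨⟩
    exact mem_of_position_lt h
  exact (position_le_iff_of_sublist (E.eadamProfile_sublist W (k + 1) i) (E.pref_nodup i)
    (E.da_mem _ i) (E.da_eadamProfile_mem_succ W k i)).mp
      (hst.position_da_le (E.eadamProfile_nodup W (k + 1)) (E.da_feasible _)
        (E.da_eadamProfile_mem_succ W k) i)

theorem position_da_eadamProfile_antitone (i : I) :
    Antitone fun k => position (E.pref i) (E.da (E.eadamProfile W k) i) :=
  antitone_nat_of_succ_le fun k => E.position_da_eadamProfile_succ_le W k i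

theorem position_eadam_le_da (k : ℕ) (i : I) :
    position (E.pref i) (E.eadam W i) ≤ position (E.pref i) (E.da (E.eadamProfile W k) i) := by
  rcases le_total k (totalLength E.pref) with h | h
  · exact E.position_da_eadamProfile_antitone W i h
  · suffices E.eadamProfile W k = E.eadamProfile W (totalLength E.pref) by rw [this]; rfl
    induction k, h using Nat.le_induction with
    | base => rfl
    | succ k _ ih =>
      funext j
      rw [eadamProfile_succ, ih, eadamRound, List.filter_eq_self.mpr]
      intro s _
      simpa using E.not_lastPair_eadamProfile_totalLength W j s

theorem position_eadam_le (i : I) :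
    position (E.pref i) (E.eadam W i) ≤ position (E.pref i) (E.sosm i) :=
  E.position_eadam_le_da W 0 i

theorem eadam_mem (i : I) (s : S) (h : E.eadam W i = some s) : s ∈ E.pref i :=
  (E.eadamProfile_sublist W _ i).subset (E.da_mem _ i s h)

/-- The EADAM outcome is constrained efficient: it is not Pareto dominated by a matching
that respects the priorities of the students outside `W`. -/
theorem eq_eadam_of_respectsPriorities {D : I → Option S} (hf : E.Feasible D)
    (hmem : ∀ i s, D i = some s → s ∈ E.pref i)
    (hle : ∀ i, position (E.pref i) (D i) ≤ position (E.pref i) (E.eadam W i))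
    (hD : E.RespectsPriorities W E.pref D) : D = E.eadam W := by
  have hlek : ∀ k, (∀ i s, D i = some s → s ∈ E.eadamProfile W k i) → ∀ i,
      position (E.eadamProfile W k i) (D i) ≤
        position (E.eadamProfile W k i) (E.da (E.eadamProfile W k) i) := fun k hk i =>
    (position_le_iff_of_sublist (E.eadamProfile_sublist W k i) (E.pref_nodup i) (hk i)
      (E.da_mem _ i)).mpr ((hle i).trans (E.position_eadam_le_da W k i))
  have hDk : ∀ k, E.RespectsPriorities W (E.eadamProfile W k) D := by
    intro k h hW s hs
    rw [E.eadamProfile_of_notMem W (fun h' => hW (E.lastInterrupters_subset W h'))] at hs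
    exact hD h hW s hs
  -- Removing an assignment of `D` would need a last pair at its rejection, but a later pair with
  -- interrupter in `W` exists.
  have hk : ∀ k i s, D i = some s → s ∈ E.eadamProfile W k i := by
    intro k
    induction k with
    | zero => exact hmem
    | succ k ih =>
      refine fun i s hi => (E.mem_eadamProfile_succ W).mpr ⟨ih i s hi, fun ⟨_, t, ht, hmax⟩ => ?_⟩
      obtain ⟨t', htt', h, hW, u, hu⟩ := exists_interruptingPair_gt (E.eadamProfile_nodup W k) hf
        ih (hlek k ih) (hDk k) hi ht.1
      exact (hmax h hW u t' hu).not_gt htt'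
  by_contra hne
  obtain ⟨i, hi⟩ := Function.ne_iff.mp hne
  set T := totalLength E.pref with hT
  have hn := E.eadamProfile_nodup W T
  have hlt : position (E.eadamProfile W T i) (D i) <
      position (E.eadamProfile W T i) (E.da (E.eadamProfile W T) i) :=
    lt_of_le_of_ne (hlek T (hk T) i) fun e =>
      hi (eq_of_position_eq (hk T i) (E.da_mem _ i) e)
  cases hDi : D i with
  | none =>
    rw [hDi] at hlt
    exact (position_le_length _ _).not_gt hlt
  | some s =>
    rw [hDi, E.position_da hn] at hlt
    obtain ⟨r, -, hr⟩ := E.exists_rejectedAt_of_position_lt hn hlt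
    obtain ⟨t', -, h, hW, u, hu⟩ := exists_interruptingPair_gt hn hf (hk T) (hlek T (hk T))
      (hDk T) hDi hr
    classical
    -- Any remaining interrupting pair with interrupter in `W` yields a last one, although EADAM has
    -- stopped.
    let Q : ℕ → Prop := fun t => ∃ h ∈ W, ∃ u, E.InterruptingPair (E.eadamProfile W T) h u t
    have hb : ∀ t, Q t → t ≤ totalLength (E.eadamProfile W T) :=
      fun t ⟨_, _, _, h⟩ => (RejectedAt.lt_totalLength h.1).le
    have hQ : Q t' := ⟨h, hW, u, hu⟩
    obtain ⟨j, hj, v, hv⟩ : Q (Nat.findGreatest Q (totalLength (E.eadamProfile W T))) :=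
      Nat.findGreatest_spec (hb t' hQ) hQ
    refine E.not_lastPair_eadamProfile_totalLength W j v ⟨hj, _, hv, fun j' hj' u' t'' h'' => ?_⟩
    have hQ'' : Q t'' := ⟨j', hj', u', h''⟩
    exact Nat.le_findGreatest (hb t'' hQ'') hQ''

end Eadam

end SchoolChoice

namespace SchoolChoice

/-! ### Falsified lists and the outcome of a coalition -/

section Coalition

variable {I S : Type*} [Fintype I] [DecidableEq S] {E : SchoolChoice I S}

theorem exists_leftPart_append (i : I) : ∃ l, E.pref i = E.leftPart i ++ l ∧
    l.head? = E.sosm i ∧ l.tail = E.rightPart i := by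
  cases h : E.sosm i with
  | none => exact ⟨[], by simp [leftPart, rightPart, h]⟩
  | some s =>
    have hs : s ∈ E.pref i := E.da_mem _ i s h
    refine ⟨(E.pref i).dropWhile fun u => u ≠ s, ?_, ?_, ?_⟩
    · simp [leftPart, h]
    · have hne : ((E.pref i).dropWhile fun u => decide (u ≠ s)) ≠ [] := by
        intro e
        simpa using List.dropWhile_eq_nil_iff.mp e s hs
      have := List.head_dropWhile_not (fun u => decide (u ≠ s)) hne
      rw [List.head?_eq_some_head hne]
      simpa using this
    · simp [rightPart, h]

theorem mem_leftPart_iff {i : I} {u : S} :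
    u ∈ E.leftPart i ↔ E.Prefers i (some u) (E.sosm i) := by
  obtain ⟨l, h1, h2, -⟩ := E.exists_leftPart_append i
  have hn := E.pref_nodup i
  rw [h1] at hn
  rw [Prefers, h1, ← h2, position_append_head? hn, position_append_lt_iff]

variable {σ : Equiv.Perm I} {i : I} {l : List S}

open Classical in
-- With `l' = []` for an unassigned student, both cases of the definition take one form, in which
-- the SOSM assignment has position `L.length`.
theorem IsFalsifiedList.exists_append (h : E.IsFalsifiedList σ i l) : ∃ L l', l = L ++ l' ∧
    l'.head? = E.sosm i ∧ l.Nodup ∧ L.Perm ((E.leftPart i).filter fun s => s ∉ E.moved σ i) ∧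
    (σ i ≠ i → L = (E.leftPart i).filter fun s => s ∉ E.moved σ i) := by
  obtain ⟨L, R, hL, hL', hR, hl⟩ := h
  obtain ⟨m, h1, h2, h3⟩ := E.exists_leftPart_append i
  have hn := E.pref_nodup i
  cases hs : E.sosm i with
  | none =>
    rw [hs] at hl
    refine ⟨L, [], by simpa using hl, rfl, ?_, hL, hL'⟩
    obtain rfl : l = L := hl
    rw [h1] at hn
    exact hL.nodup_iff.mpr (hn.of_append_left.filter _)
  | some s =>
    rw [hs] at hl h2
    refine ⟨L, s :: R, hl, rfl, ?_, hL, hL'⟩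
    have hm : m = s :: E.rightPart i := by
      rw [← h3]
      exact List.eq_cons_of_mem_head? h2
    rw [hm] at h1
    have hperm : l.Perm (E.pref i) := by
      rw [show l = L ++ s :: R from hl, h1]
      have hsplit : ((E.leftPart i).filter (fun s => s ∈ E.moved σ i) ++
          (E.leftPart i).filter fun s => s ∉ E.moved σ i).Perm (E.leftPart i) := by
        simpa using List.filter_append_perm (fun s => decide (s ∈ E.moved σ i)) (E.leftPart i)
      rw [List.perm_iff_count] at hL hR hsplit ⊢
      intro a
      have h1 := hL a
      have h2 := hR a
      have h3 := hsplit a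
      simp only [List.count_append, List.count_cons] at h1 h2 h3 ⊢
      omega
    exact hperm.nodup_iff.mpr hn

theorem IsFalsifiedList.nodup (h : E.IsFalsifiedList σ i l) : l.Nodup := by
  obtain ⟨L, l', -, -, hn, -⟩ := h.exists_append
  exact hn

theorem IsFalsifiedList.position_lt_sosm_iff (h : E.IsFalsifiedList σ i l) {u : S} :
    position l (some u) < position l (E.sosm i) ↔
      E.Prefers i (some u) (E.sosm i) ∧ u ∉ E.moved σ i := by
  classical
  obtain ⟨L, l', h1, h2, h3, h4, -⟩ := h.exists_append
  rw [h1] at h3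
  rw [h1, ← h2, position_append_head? h3, position_append_lt_iff, h4.mem_iff, List.mem_filter,
    mem_leftPart_iff, h2]
  simp

theorem IsFalsifiedList.sosm_mem (h : E.IsFalsifiedList σ i l) {s : S} (hs : E.sosm i = some s) :
    s ∈ l := by
  obtain ⟨L, l', h1, h2, -⟩ := h.exists_append
  rw [h1]
  exact List.mem_append_right _ (List.mem_of_mem_head? (h2.trans hs))

/-- Members of the cabal keep the true order of the schools that they prefer to their
assignment and do not move down. -/
theorem IsFalsifiedList.position_lt_iff (h : E.IsFalsifiedList σ i l) (hσ : σ i ≠ i) {u v : S}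
    (hu : E.Prefers i (some u) (E.sosm i) ∧ u ∉ E.moved σ i)
    (hv : E.Prefers i (some v) (E.sosm i) ∧ v ∉ E.moved σ i) :
    position l (some u) < position l (some v) ↔ E.Prefers i (some u) (some v) := by
  classical
  obtain ⟨L, l', h1, h2, h3, h4, h5⟩ := h.exists_append
  obtain ⟨m, hm, -, -⟩ := E.exists_leftPart_append i
  rw [← mem_leftPart_iff] at hu hv
  have hL := h5 hσ
  have hu' : u ∈ L := by rw [hL]; simpa using hu
  have hv' : v ∈ L := by rw [hL]; simpa using hv
  have hsub : L.Sublist (E.pref i) := by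
    rw [hL, hm]
    exact List.filter_sublist.trans (List.sublist_append_left _ _)
  rw [h1, position_append_of_mem hu', position_append_of_mem hv']
  exact position_lt_iff_of_sublist hsub (E.pref_nodup i) (by rintro _ ⟨⟩; exact hu')
    (by rintro _ ⟨⟩; exact hv')

variable {W : Set I}

/-- A student for whom a school obstructs that is truly better than the EADAM assignment is a
consenting last interrupter. -/
theorem Obstructs.mem_lastInterrupters (hσN : ∀ i, E.eadam W i = E.sosm (σ i)) {u : S}
    (h : E.Obstructs σ i u) (hu : E.Prefers i (some u) (E.eadam W i)) :
    i ∈ E.lastInterrupters W := by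
  by_contra hi
  obtain ⟨k, -, hk, -, hrank⟩ := h
  -- In the EADAM outcome `u` admits `σ⁻¹ k`, whom `i` beats. If `i` kept her true list through all
  -- rounds, this would contradict stability of the last run.
  have h1 : E.eadam W (σ⁻¹ k) = some u := by rw [hσN]; simpa using hk
  have hpos : position (E.eadamProfile W (totalLength E.pref) i) (some u) <
      position (E.eadamProfile W (totalLength E.pref) i) (E.eadam W i) := by
    rw [E.eadamProfile_of_notMem W hi]
    exact hu
  have h2 := E.da_stableFor (E.eadamProfile_nodup W _) i u hpos
  exact ((E.da_feasible _).rank_lt h2 h1).not_gt hrank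

/-- If a student prefers `u` to the EADAM assignment and `u` could admit her, then the falsified
lists move `u` down. -/
theorem mem_moved_of_not_stable (hσ : ∀ i, σ i ≠ i ↔ E.sosm i ≠ E.eadam W i)
    (hσN : ∀ i, E.eadam W i = E.sosm (σ i))
    (hcard : ∀ a, (Finset.univ.filter fun i => E.eadam W i = a).card =
      (Finset.univ.filter fun i => E.sosm i = a).card) {u : S}
    (hu : E.Prefers i (some u) (E.eadam W i))
    (hst : ¬ E.cap u ≤
      (Finset.univ.filter fun j => E.eadam W j = some u ∧ E.rank u j < E.rank u i).card) :
    u ∈ E.moved σ i := by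
  have huM : E.Prefers i (some u) (E.sosm i) := lt_of_lt_of_le hu (E.position_eadam_le W i)
  have hneN : E.eadam W i ≠ some u := fun e => by
    rw [e] at hu
    exact lt_irrefl _ hu
  have hM := E.da_stableFor E.pref_nodup i u huM
  have hfull : E.cap u ≤ (Finset.univ.filter fun i => E.eadam W i = some u).card := by
    rw [hcard]
    refine hM.trans (Finset.card_le_card fun k => ?_)
    simp only [Finset.mem_filter, Finset.mem_univ, true_and]
    exact fun h => h.1
  obtain ⟨j, hj, hrank⟩ : ∃ j, E.eadam W j = some u ∧ ¬ E.rank u j < E.rank u i := by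
    by_contra! hall
    refine hst (hfull.trans (Finset.card_le_card fun k => ?_))
    simp only [Finset.mem_filter, Finset.mem_univ, true_and]
    exact fun h => ⟨h, hall k h⟩
  have hij : i ≠ j := fun e => hneN (e ▸ hj)
  -- All SOSM occupants of `u` beat `i`, so `j` is new there and lies in the cabal; `σ j` is then
  -- the witness for obstruction.
  have hjM : E.sosm j ≠ some u := fun e => hrank ((E.da_feasible _).rank_lt hM e)
  have hjσ : σ j ≠ j := (hσ j).mpr fun e => hjM (e.trans hj)
  refine ⟨⟨σ j, fun e => hjσ (σ.injective e), (hσN j).symm.trans hj, huM, ?_⟩, ?_⟩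
  · have : E.rank u i ≠ E.rank u j := fun e => hij (E.rank_injective u e)
    rw [show σ⁻¹ (σ j) = j from σ.symm_apply_apply j]
    omega
  · rw [← hσN]
    exact hneN

/-- A coalition obtains the EADAM outcome if the accomplice set contains all the students who could
block this outcome, and all the non-consenting accomplices belong to the cabal. -/
theorem da_eq_eadam_of_isCoalitionProfile (hσ : ∀ i, σ i ≠ i ↔ E.sosm i ≠ E.eadam W i)
    (hσN : ∀ i, E.eadam W i = E.sosm (σ i))
    (hcard : ∀ a, (Finset.univ.filter fun i => E.eadam W i = a).card =
      (Finset.univ.filter fun i => E.sosm i = a).card) {A : Set I}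
    (hA : ∀ i u, E.Obstructs σ i u → E.Prefers i (some u) (E.eadam W i) → i ∈ A)
    (hA' : ∀ i ∈ A, i ∉ W → σ i ≠ i) {Q : I → List S} (hQ : E.IsCoalitionProfile σ A Q) :
    E.da Q = E.eadam W := by
  have hcab : ∀ i, σ i ≠ i → E.Prefers i (E.eadam W i) (E.sosm i) := fun i hi =>
    lt_of_le_of_ne (E.position_eadam_le W i) fun e =>
      (hσ i).mp hi (eq_of_position_eq (E.eadam_mem W i) (E.da_mem _ i) e).symm
  have hfix : ∀ i, σ i = i → E.eadam W i = E.sosm i := fun i hi => by rw [hσN, hi]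
  have hnmoved : ∀ i u, E.eadam W i = some u → u ∉ E.moved σ i := fun i u hu h =>
    h.2 ((hσN i).symm.trans hu)
  have hQn : ∀ i, (Q i).Nodup := by
    intro i
    by_cases hi : i ∈ A
    · exact ((hQ i).1 hi).nodup
    · rw [(hQ i).2 hi]
      exact E.pref_nodup i
  have hNmem : ∀ i s, E.eadam W i = some s → s ∈ Q i := by
    intro i s hs
    by_cases hi : i ∈ A
    · have hf := (hQ i).1 hi
      by_cases hσi : σ i = i
      · exact hf.sosm_mem ((hfix i hσi).symm.trans hs)
      · exact mem_of_position_lt (hf.position_lt_sosm_iff.mpr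
          ⟨hs ▸ hcab i hσi, hnmoved i s hs⟩)
    · rw [(hQ i).2 hi]
      exact E.eadam_mem W i s hs
  -- what a student prefers to the EADAM assignment in the submitted list is truly better
  have htrue : ∀ i u, position (Q i) (some u) < position (Q i) (E.eadam W i) →
      E.Prefers i (some u) (E.eadam W i) ∧ (i ∈ A → u ∉ E.moved σ i) := by
    intro i u hu
    by_cases hi : i ∈ A
    · have hf := (hQ i).1 hi
      by_cases hσi : σ i = i
      · rw [hfix i hσi] at hu ⊢
        have := hf.position_lt_sosm_iff.mp hu
        exact ⟨this.1, fun _ => this.2⟩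
      · have hN := hcab i hσi
        cases hNi : E.eadam W i with
        | none =>
          rw [hNi] at hN
          exact absurd hN (position_le_length _ _).not_gt
        | some v =>
          rw [hNi] at hu hN
          have hv := And.intro hN (hnmoved i v hNi)
          have hu' := hf.position_lt_sosm_iff.mp (hu.trans (hf.position_lt_sosm_iff.mpr hv))
          exact ⟨(hf.position_lt_iff hσi hu' hv).mp hu, fun _ => hu'.2⟩
    · rw [(hQ i).2 hi] at hu
      exact ⟨hu, fun h => absurd h hi⟩
  have hst : E.StableFor Q (E.eadam W) := by
    intro i u hu
    obtain ⟨hu', hmv⟩ := htrue i u hu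
    by_contra hcon
    have hmoved := mem_moved_of_not_stable hσ hσN hcard hu' hcon
    exact hmv (hA i u hmoved.1 hu') hmoved
  have hDle := hst.position_da_le hQn (E.da_feasible _) hNmem
  have hDcases : ∀ i, E.da Q i = E.eadam W i ∨ ∃ u, E.da Q i = some u ∧
      position (Q i) (some u) < position (Q i) (E.eadam W i) := by
    intro i
    rcases (hDle i).eq_or_lt with h | h
    · exact Or.inl (eq_of_position_eq (E.da_mem _ i) (hNmem i) h)
    · cases hDi : E.da Q i with
      | none =>
        rw [hDi] at h
        exact absurd h (position_le_length _ _).not_gt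
      | some u => exact Or.inr ⟨u, rfl, hDi ▸ h⟩
  refine E.eq_eadam_of_respectsPriorities W (E.da_feasible _) ?_ ?_ ?_
  · intro i s hs
    rcases hDcases i with h | ⟨u, h, h'⟩
    · exact E.eadam_mem W i s (h.symm.trans hs)
    · obtain rfl := Option.some.inj (h.symm.trans hs)
      exact mem_of_position_lt (htrue i u h').1
  · intro i
    rcases hDcases i with h | ⟨u, h, h'⟩
    · rw [h]
    · rw [h]
      exact le_of_lt (htrue i u h').1
  -- It suffices that true envy of `h` is also envy in her submitted list, since the outcome is
  -- stable for `Q`.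
  · intro h hW s hs j hj hrank
    have hpos : position (Q h) (some s) < position (Q h) (E.da Q h) := by
      by_cases hi : h ∈ A
      · have hf := (hQ h).1 hi
        have hσh := hA' h hi hW
        have hD : ∃ v, E.da Q h = some v ∧
            E.Prefers h (some v) (E.sosm h) ∧ v ∉ E.moved σ h := by
          rcases hDcases h with e | ⟨u, e, h'⟩
          · have hN := hcab h hσh
            rw [e]
            cases hNi : E.eadam W h with
            | none =>
              rw [hNi] at hN
              exact absurd hN (position_le_length _ _).not_gt
            | some v => exact ⟨v, rfl, hNi ▸ hN, hnmoved h v hNi⟩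
          · exact ⟨u, e, lt_of_lt_of_le (htrue h u h').1 (E.position_eadam_le W h),
              (htrue h u h').2 hi⟩
        obtain ⟨v, hv, hv'⟩ := hD
        rw [hv] at hs ⊢
        have hsN : E.Prefers h (some s) (E.eadam W h) := by
          rcases hDcases h with e | ⟨u, e, h'⟩
          · rw [← e, hv]
            exact hs
          · obtain rfl := Option.some.inj (e.symm.trans hv)
            exact lt_trans hs (htrue h u h').1
        have hsX : s ∉ E.moved σ h := fun hmv =>
          hW (E.lastInterrupters_subset W (hmv.1.mem_lastInterrupters hσN hsN))
        exact (hf.position_lt_iff hσh ⟨lt_trans hs hv'.1, hsX⟩ hv').mpr hs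
      · rw [(hQ h).2 hi]
        exact hs
    exact ((E.da_feasible _).rank_lt (E.da_stableFor hQn h s hpos) hj).not_gt hrank

end Coalition

end SchoolChoice

theorem theoremT {I S : Type*} [Fintype I] [DecidableEq S]
    (E : SchoolChoice I S) (W : Set I) :
    ∃ σ : Equiv.Perm I,
      -- the cabal is the set of students whose assignment changes, split into cabal loops
      (∀ i, σ i ≠ i ↔ E.sosm i ≠ E.eadam W i) ∧
      E.IsCabal σ ∧
      -- EADAM moves every student of a loop to the SOSM assignment of the preceding student
      (∀ i, E.eadam W i = E.sosm (σ i)) ∧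
      -- the EADAM outcome improves on SOSM
      (E.eadam W ≠ E.sosm → E.ParetoDominates (E.eadam W) E.sosm) ∧
      -- it is the SOSM outcome if the consenting last interrupters falsify their lists
      (∀ P, E.IsCoalitionProfile σ (E.lastInterrupters W) P → E.da P = E.eadam W) ∧
      -- and also if the accomplice set of the cabal does
      (∀ P, E.IsCoalitionProfile σ (E.accomplices σ) P → E.da P = E.eadam W) := by
  have hcard : ∀ a, (Finset.univ.filter fun i => E.eadam W i = a).card =
      (Finset.univ.filter fun i => E.sosm i = a).card := fun a =>
    SchoolChoice.Feasible.card_eq E.pref_nodup (E.da_feasible _) (E.eadam_mem W)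
      (E.position_eadam_le W) a
  have hlt : ∀ i, E.sosm i ≠ E.eadam W i → E.Prefers i (E.eadam W i) (E.sosm i) := fun i hi =>
    lt_of_le_of_ne (E.position_eadam_le W i) fun e =>
      hi (SchoolChoice.eq_of_position_eq (E.eadam_mem W i) (E.da_mem _ i) e).symm
  obtain ⟨σ, hσN, hσ⟩ := SchoolChoice.exists_perm_comp_eq E.sosm (E.eadam W) hcard
  refine ⟨σ, hσ, fun i hi => ?_, hσN, fun hne => ⟨E.position_eadam_le W, ?_⟩, fun P hP => ?_,
    fun P hP => ?_⟩
  · rw [← hσN]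
    exact hlt i ((hσ i).mp hi)
  · obtain ⟨j, hj⟩ := Function.ne_iff.mp hne
    exact ⟨j, hlt j hj.symm⟩
  · exact SchoolChoice.da_eq_eadam_of_isCoalitionProfile hσ hσN hcard
      (fun i u h hu => h.mem_lastInterrupters hσN hu)
      (fun i hi hW => absurd (E.lastInterrupters_subset W hi) hW) hP
  -- An accomplice outside the cabal has equal SOSM and EADAM assignments, so her obstructing school
  -- is truly better than the latter, which puts her in `W`.
  · refine SchoolChoice.da_eq_eadam_of_isCoalitionProfile hσ hσN hcard (A := E.accomplices σ)
      (fun i u h _ => ⟨u, h⟩) (fun i hi hW hfix => hW ?_) hP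
    obtain ⟨u, hu⟩ := hi
    have huM : E.Prefers i (some u) (E.sosm i) := hu.choose_spec.2.2.1
    refine E.lastInterrupters_subset W (hu.mem_lastInterrupters hσN ?_)
    rw [hσN, hfix]
    exact huM
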